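/- Let $d\ge 1$, $a>0$, $\alpha>0$, and let $\tilde{x}\in\mathbb{R}^d$ be a unit vector. Consider the Cauchy covariance $C^{\Re}(h)=(1+a^2\|h\|^2)^{-\alpha}$, $h\in\mathbb{R}^d$. It has a spectral density, that is, a nonnegative integrable function $f$ on $\mathbb{R}^d$ with $C^{\Re}(h)=\int_{\mathbb{R}^d} e^{i\langle h,x\rangle} f(x)\,dx$ for all $h\in\mathbb{R}^d$. For every such $f$, the asymmetric part corresponding to the Fourier multiplier $-i\,\mathrm{sign}(\langle x,\tilde{x}\rangle)$, that is, the function $$C^{\Im}(h)=\int_{\mathbb{R}^d} e^{i\langle h,x\rangle}\,\{-i\,\mathrm{sign}(\langle x,\tilde{x}\rangle)\}\,f(x)\,dx ,$$ is given for all $h\in\mathbb{R}^d$ by $$C^{\Im}(h)=\frac{1}{(a^2\|h\|^2+1)^{\alpha}}\,\frac{2}{\sqrt{\pi}}\,\frac{\Gamma(\alpha+\frac12)}{\Gamma(\alpha)}\,\frac{a\langle h,\tilde{x}\rangle}{(a^2\|h\|^2+1)^{1/2}}\;{}_2F_1\!\left(\frac12,\frac12+\alpha;\frac32;\frac{a^2\langle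 h,\tilde{x}\rangle^2}{a^2\|h\|^2+1}\right),$$ where ${}_2F_1$ is the Gauss hypergeometric function. -/

import Mathlib

open MeasureTheory

/-- The Cauchy covariance `h ↦ (1 + a² ‖h‖²) ^ (-α)` on `ℝ^d`. -/
noncomputable def cauchyCovariance {d : ℕ} (a α : ℝ) (h : EuclideanSpace ℝ (Fin d)) : ℝ :=
  (1 + a ^ 2 * ‖h‖ ^ 2) ^ (-α)

/-- `f` is a spectral density of the function `C` on `ℝ^d`: it is nonnegative, integrable, and
`C h = ∫ exp(i⟨h, x⟩) f(x) dx` for all `h`. -/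
structure IsSpectralDensity {d : ℕ} (C f : EuclideanSpace ℝ (Fin d) → ℝ) : Prop where
  nonneg : ∀ x, 0 ≤ f x
  integrable : Integrable f
  eq_integral : ∀ h, (C h : ℂ) = ∫ x, Complex.exp (Complex.I * (inner ℝ h x : ℝ)) * (f x : ℂ)

/-- The asymmetric part with direction `xt` built from the spectral density `f`, that is, the
inverse Fourier integral of `f` after application of the multiplier `-i sign⟨x, xt⟩`:
`h ↦ ∫ exp(i⟨h, x⟩) {-i sign⟨x, xt⟩} f(x) dx`. -/
noncomputable def asymmetricPart {d : ℕ} (xt : EuclideanSpace ℝ (Fin d))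
    (f : EuclideanSpace ℝ (Fin d) → ℝ) (h : EuclideanSpace ℝ (Fin d)) : ℂ :=
  ∫ x, Complex.exp (Complex.I * (inner ℝ h x : ℝ)) *
    (-Complex.I * (Real.sign (inner ℝ x xt) : ℂ)) * (f x : ℂ)

/-! The Cauchy covariance is a Gamma mixture of Gaussians: `(1 + u) ^ (-α)` is the Laplace transform
of `gammaWeight α`, and `exp (-t a² ‖h‖²)` is the Fourier integral of the Gaussian density with `b =
1 / (4 t a²)`. By Fubini (`integral_mul_cauchySpectralDensity`) any bounded multiplier may be
applied to each Gaussian separately.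

For one Gaussian, rotate `xt` onto a coordinate axis. The integral factors, and the sign touches a
single factor, which is a Dawson-type function `exp (-c² / (4b)) ∫₀ᶜ exp (y² / (4b)) dy` with `c =
⟨h, xt⟩` (`integral_sign_fourier_isotropicGaussian`).

Expanding the last integral in powers of `t` and integrating against the Gamma weight term by term
gives the hypergeometric series (`integral_rpow_mul_exp_mul_integral_exp_sq`); by Cauchy–Schwarz its
argument is below 1. Injectivity of the characteristic function (`IsSpectralDensity.ae_eq`) carries
the result to every spectral density. -/

theorem measurable_realSign : Measurable Real.sign := by
  unfold Real.sign
  exact Measurable.ite measurableSet_Iio measurable_const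
    (Measurable.ite measurableSet_Ioi measurable_const measurable_const)

theorem abs_realSign_le_one (x : ℝ) : |Real.sign x| ≤ 1 := by
  rcases Real.sign_apply_eq x with h | h | h <;> simp [h]

/-! ### One-dimensional Gaussian integrals with a sign -/

theorem hasDerivAt_integral_sin_mul_gaussian {b : ℝ} (hb : 0 < b) (c : ℝ) :
    HasDerivAt (fun c ↦ ∫ x in Set.Ioi (0 : ℝ), Real.sin (c * x) * Real.exp (-b * x ^ 2))
      (∫ x in Set.Ioi (0 : ℝ), Real.cos (c * x) * x * Real.exp (-b * x ^ 2)) c := by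
  refine (hasDerivAt_integral_of_dominated_loc_of_deriv_le
    (F := fun c x ↦ Real.sin (c * x) * Real.exp (-b * x ^ 2))
    (F' := fun c x ↦ Real.cos (c * x) * x * Real.exp (-b * x ^ 2))
    (bound := fun x ↦ ‖x * Real.exp (-b * x ^ 2)‖) Filter.univ_mem ?_ ?_ ?_ ?_ ?_ ?_).2
  · exact .of_forall fun c ↦ (by fun_prop : Continuous _).aestronglyMeasurable
  · refine (integrable_exp_neg_mul_sq hb).restrict.mono'
      (by fun_prop : Continuous _).aestronglyMeasurable (.of_forall fun x ↦ ?_)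
    rw [norm_mul, Real.norm_of_nonneg (Real.exp_pos _).le]
    exact mul_le_of_le_one_left (Real.exp_pos _).le (Real.abs_sin_le_one _)
  · exact (by fun_prop : Continuous _).aestronglyMeasurable
  · refine .of_forall fun x c _ ↦ ?_
    rw [mul_assoc, norm_mul]
    exact mul_le_of_le_one_left (norm_nonneg _) (Real.abs_cos_le_one _)
  · exact (integrable_mul_exp_neg_mul_sq hb).norm.restrict
  · refine .of_forall fun x c _ ↦ ?_
    have h : HasDerivAt (fun c : ℝ ↦ c * x) x c := by simpa using (hasDerivAt_id c).mul_const x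
    exact h.sin.mul_const _

/-- Integration by parts with the primitive `-exp (-b x²) / (2b)` of `x exp (-b x²)`; the boundary
value at 0 gives `1 / (2b)`. -/
theorem integral_cos_mul_id_mul_gaussian {b : ℝ} (hb : 0 < b) (c : ℝ) :
    ∫ x in Set.Ioi (0 : ℝ), Real.cos (c * x) * x * Real.exp (-b * x ^ 2) =
      1 / (2 * b) - c / (2 * b) *
        ∫ x in Set.Ioi (0 : ℝ), Real.sin (c * x) * Real.exp (-b * x ^ 2) := by
  have hs : IntegrableOn (fun x : ℝ ↦ Real.sin (c * x) * Real.exp (-b * x ^ 2)) (Set.Ioi 0) := by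
    refine (integrable_exp_neg_mul_sq hb).restrict.mono'
      (by fun_prop : Continuous _).aestronglyMeasurable (.of_forall fun x ↦ ?_)
    rw [norm_mul, Real.norm_of_nonneg (Real.exp_pos _).le]
    exact mul_le_of_le_one_left (Real.exp_pos _).le (Real.abs_sin_le_one _)
  have hc : IntegrableOn (fun x : ℝ ↦ Real.cos (c * x) * x * Real.exp (-b * x ^ 2))
      (Set.Ioi 0) := by
    refine (integrable_mul_exp_neg_mul_sq hb).norm.restrict.mono'
      (by fun_prop : Continuous _).aestronglyMeasurable (.of_forall fun x ↦ ?_)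
    rw [mul_assoc, norm_mul]
    exact mul_le_of_le_one_left (norm_nonneg _) (Real.abs_cos_le_one _)
  have key := integral_Ioi_of_hasDerivAt_of_tendsto (a := (0 : ℝ)) (m := (0 : ℝ))
    (f := fun x ↦ -(1 / (2 * b)) * (Real.cos (c * x) * Real.exp (-b * x ^ 2)))
    (f' := fun x ↦ Real.cos (c * x) * x * Real.exp (-b * x ^ 2) +
      c / (2 * b) * (Real.sin (c * x) * Real.exp (-b * x ^ 2)))
    (by fun_prop : Continuous _).continuousWithinAt ?_ (hc.add (hs.const_mul _)) ?_
  · rw [integral_add hc (hs.const_mul _), integral_const_mul] at key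
    simp only [mul_zero, Real.cos_zero, ne_eq, OfNat.ofNat_ne_zero, not_false_eq_true, zero_pow,
      Real.exp_zero, mul_one] at key
    linarith
  · intro x _
    have h1 : HasDerivAt (fun x : ℝ ↦ c * x) c x := by simpa using (hasDerivAt_id x).const_mul c
    have h2 : HasDerivAt (fun x : ℝ ↦ -b * x ^ 2) (-b * (2 * x)) x := by
      simpa using (hasDerivAt_pow 2 x).const_mul (-b)
    refine ((h1.cos.mul h2.exp).const_mul (-(1 / (2 * b)))).congr_deriv ?_
    field_simp
    ring
  · have h0 : Filter.Tendsto (fun x : ℝ ↦ Real.exp (-b * x ^ 2)) Filter.atTop (nhds 0) := by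
      refine Real.tendsto_exp_atBot.comp ?_
      exact (Filter.tendsto_pow_atTop two_ne_zero).const_mul_atTop_of_neg (neg_lt_zero.2 hb)
    have h1 : Filter.Tendsto (fun x : ℝ ↦ Real.cos (c * x) * Real.exp (-b * x ^ 2))
        Filter.atTop (nhds 0) := by
      refine squeeze_zero_norm (fun x ↦ ?_) h0
      rw [norm_mul, Real.norm_of_nonneg (Real.exp_pos _).le]
      exact mul_le_of_le_one_left (Real.exp_pos _).le (Real.abs_cos_le_one _)
    simpa using h1.const_mul (-(1 / (2 * b)))

/-- The left side `F` solves `F' = 1 / (2b) - c F / (2b)` with `F 0 = 0`; `exp (c² / (4b))` is the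
integrating factor. -/
theorem integral_sin_mul_gaussian {b : ℝ} (hb : 0 < b) (c : ℝ) :
    ∫ x in Set.Ioi (0 : ℝ), Real.sin (c * x) * Real.exp (-b * x ^ 2) =
      1 / (2 * b) * Real.exp (-c ^ 2 / (4 * b)) * ∫ y in (0 : ℝ)..c, Real.exp (y ^ 2 / (4 * b)) := by
  set F : ℝ → ℝ := fun c ↦ ∫ x in Set.Ioi (0 : ℝ), Real.sin (c * x) * Real.exp (-b * x ^ 2)
  have hD : ∀ c, HasDerivAt (fun c ↦ F c * Real.exp (c ^ 2 / (4 * b)) -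
      1 / (2 * b) * ∫ y in (0 : ℝ)..c, Real.exp (y ^ 2 / (4 * b))) 0 c := by
    intro c
    have h1 := hasDerivAt_integral_sin_mul_gaussian hb c
    rw [integral_cos_mul_id_mul_gaussian hb c] at h1
    have h2 : HasDerivAt (fun x : ℝ ↦ x ^ 2 / (4 * b)) (2 * c / (4 * b)) c := by
      simpa using (hasDerivAt_pow 2 c).div_const (4 * b)
    have h3 : HasDerivAt (fun c ↦ ∫ y in (0 : ℝ)..c, Real.exp (y ^ 2 / (4 * b)))
        (Real.exp (c ^ 2 / (4 * b))) c :=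
      intervalIntegral.integral_hasDerivAt_right
        ((by fun_prop : Continuous _).intervalIntegrable _ _)
        ((by fun_prop : Continuous _).stronglyMeasurableAtFilter _ _)
        (by fun_prop : Continuous _).continuousAt
    refine ((h1.mul h2.exp).sub (h3.const_mul (1 / (2 * b)))).congr_deriv ?_
    field_simp
    ring
  have h := is_const_of_deriv_eq_zero (fun c ↦ (hD c).differentiableAt)
    (fun c ↦ (hD c).deriv) c 0
  have h0 : F 0 = 0 := by simp [F]
  simp only [h0, zero_mul, intervalIntegral.integral_same, mul_zero, sub_zero] at h
  have he : Real.exp (-c ^ 2 / (4 * b)) * Real.exp (c ^ 2 / (4 * b)) = 1 := by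
    rw [← Real.exp_add, neg_div, neg_add_cancel, Real.exp_zero]
  change F c = _
  calc F c = Real.exp (-c ^ 2 / (4 * b)) * (F c * Real.exp (c ^ 2 / (4 * b))) := by
        rw [mul_left_comm, he, mul_one]
    _ = _ := by rw [sub_eq_zero.1 h]; ring

/-- The multiplier is odd, so folding `x` onto `-x` cancels the cosine and doubles the sine. -/
theorem integral_sign_fourier_gaussian {b : ℝ} (hb : 0 < b) (c : ℝ) :
    ∫ x : ℝ, Complex.exp (Complex.I * (c * x : ℝ)) * (-Complex.I * (Real.sign x : ℂ)) *
        (Real.exp (-b * x ^ 2) : ℂ) =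
      ((1 / b * Real.exp (-c ^ 2 / (4 * b)) *
        ∫ y in (0 : ℝ)..c, Real.exp (y ^ 2 / (4 * b)) : ℝ) : ℂ) := by
  set G : ℝ → ℂ := fun x ↦ Complex.exp (Complex.I * (c * x : ℝ)) *
    (-Complex.I * (Real.sign x : ℂ)) * (Real.exp (-b * x ^ 2) : ℂ) with hG
  have hGi : Integrable G := by
    refine (integrable_exp_neg_mul_sq hb).mono' ?_ (.of_forall fun x ↦ ?_)
    · have := measurable_realSign
      exact (by fun_prop : Measurable G).aestronglyMeasurable
    · simp only [hG, norm_mul, norm_neg, Complex.norm_I, one_mul, Complex.norm_real]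
      rw [mul_comm Complex.I, Complex.norm_exp_ofReal_mul_I, one_mul,
        Real.norm_of_nonneg (Real.exp_pos _).le]
      exact mul_le_of_le_one_left (Real.exp_pos _).le (abs_realSign_le_one x)
  have hsplit : ∫ x, G x = (∫ x in Set.Ioi (0 : ℝ), G x) + ∫ x in Set.Ioi (0 : ℝ), G (-x) := by
    rw [integral_comp_neg_Ioi, neg_zero, add_comm]
    exact (intervalIntegral.integral_Iic_add_Ioi hGi.integrableOn hGi.integrableOn).symm
  rw [hsplit, ← integral_add hGi.integrableOn hGi.comp_neg.integrableOn]
  have : ∀ x ∈ Set.Ioi (0 : ℝ), G x + G (-x) =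
      ((2 * (Real.sin (c * x) * Real.exp (-b * x ^ 2)) : ℝ) : ℂ) := by
    intro x hx
    simp only [hG, Real.sign_of_pos hx, Real.sign_of_neg (neg_lt_zero.2 hx), neg_sq]
    push_cast
    rw [Complex.sin]
    ring_nf
  rw [setIntegral_congr_fun measurableSet_Ioi this, integral_complex_ofReal, integral_const_mul,
    integral_sin_mul_gaussian hb]
  congr 1
  field_simp

theorem hasSum_integral_exp_sq (q c : ℝ) :
    HasSum (fun n : ℕ ↦ q ^ n * c ^ (2 * n + 1) / (n.factorial * (2 * n + 1)))
      (∫ y in (0 : ℝ)..c, Real.exp (q * y ^ 2)) := by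
  have h := intervalIntegral.hasSum_integral_of_dominated_convergence (μ := volume) (a := 0) (b := c)
    (F := fun (n : ℕ) (y : ℝ) ↦ (q * y ^ 2) ^ n / n.factorial)
    (f := fun y ↦ Real.exp (q * y ^ 2))
    (fun n _ ↦ (|q| * c ^ 2) ^ n / n.factorial)
    (fun n ↦ (by fun_prop : Continuous _).aestronglyMeasurable)
    (fun n ↦ .of_forall fun y hy ↦ ?_)
    (.of_forall fun y _ ↦ Real.summable_pow_div_factorial _)
    intervalIntegrable_const (.of_forall fun y _ ↦ ?_)
  · refine (congrArg (fun f : ℕ → ℝ ↦ HasSum f _) (funext fun n ↦ ?_)).mpr h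
    simp_rw [mul_pow, ← pow_mul]
    rw [intervalIntegral.integral_div, intervalIntegral.integral_const_mul, integral_pow]
    push_cast
    field_simp
    simp
  · rw [norm_div, norm_pow, norm_mul, norm_pow, RCLike.norm_natCast]
    have : ‖y‖ ^ 2 ≤ c ^ 2 := by
      rw [Real.norm_eq_abs, sq_abs]
      refine sq_le_sq.2 ?_
      rcases Set.mem_uIoc.1 hy with ⟨h1, h2⟩ | ⟨h1, h2⟩
      · rw [abs_of_pos h1, abs_of_pos (h1.trans_le h2)]; exact h2
      · rw [abs_of_nonpos h2, abs_of_neg (h1.trans_le h2)]; linarith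
    rw [Real.norm_eq_abs]
    gcongr
  · rw [Real.exp_eq_exp_ℝ]
    exact NormedSpace.expSeries_div_hasSum_exp (q * y ^ 2)

/-! ### Isotropic Gaussians on `ℝ^d` -/

theorem OrthonormalBasis.integral_eq_integral_pi {ι V : Type*} [Fintype ι] [NormedAddCommGroup V]
    [InnerProductSpace ℝ V] [FiniteDimensional ℝ V] [MeasurableSpace V] [BorelSpace V]
    (B : OrthonormalBasis ι ℝ V) {F : Type*} [NormedAddCommGroup F] [NormedSpace ℝ F] (g : V → F) :
    ∫ x, g x = ∫ y : ι → ℝ, g (B.repr.symm (WithLp.toLp 2 y)) := by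
  rw [← B.measurePreserving_repr_symm.integral_comp
      B.repr.symm.toHomeomorph.measurableEmbedding,
    ← (PiLp.volume_preserving_toLp ι).integral_comp
      (MeasurableEquiv.toLp 2 (ι → ℝ)).measurableEmbedding]

/-- The centred isotropic Gaussian density `(b / π) ^ (d / 2) * exp (-b ‖x‖²)` on `ℝ^d`. -/
noncomputable def isotropicGaussian {d : ℕ} (b : ℝ) (x : EuclideanSpace ℝ (Fin d)) : ℝ :=
  (b / Real.pi) ^ ((d : ℝ) / 2) * Real.exp (-b * ‖x‖ ^ 2)

variable {d : ℕ}

theorem isotropicGaussian_nonneg {b : ℝ} (hb : 0 < b) (x : EuclideanSpace ℝ (Fin d)) :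
    0 ≤ isotropicGaussian b x := by
  unfold isotropicGaussian; positivity

theorem integral_fourier_isotropicGaussian {b : ℝ} (hb : 0 < b) (h : EuclideanSpace ℝ (Fin d)) :
    ∫ x, Complex.exp (Complex.I * (inner ℝ h x : ℝ)) * (isotropicGaussian b x : ℂ) =
      (Real.exp (-‖h‖ ^ 2 / (4 * b)) : ℂ) := by
  have key := GaussianFourier.integral_cexp_neg_mul_sq_norm_add (b := (b : ℂ)) (by simpa using hb)
    Complex.I h
  have hpi := Real.pi_pos
  have h1 : ∀ x : EuclideanSpace ℝ (Fin d),
      Complex.exp (Complex.I * (inner ℝ h x : ℝ)) * (isotropicGaussian b x : ℂ) =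
      (((b / Real.pi) ^ ((d : ℝ) / 2) : ℝ) : ℂ) *
        Complex.exp (-b * ‖x‖ ^ 2 + Complex.I * (inner ℝ h x : ℝ)) := by
    intro x
    rw [isotropicGaussian, Complex.exp_add]
    push_cast
    ring
  simp_rw [h1]
  rw [integral_const_mul, key, finrank_euclideanSpace_fin, Complex.I_sq, ← mul_assoc]
  have h2 : ((Real.pi : ℂ) / b) ^ ((d : ℂ) / 2) = (((Real.pi / b) ^ ((d : ℝ) / 2) : ℝ) : ℂ) := by
    rw [Complex.ofReal_cpow (by positivity)]
    push_cast
    rfl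
  rw [h2, ← Complex.ofReal_mul, ← Real.mul_rpow (by positivity) (by positivity)]
  have h3 : b / Real.pi * (Real.pi / b) = 1 := by field_simp
  rw [h3, Real.one_rpow]
  push_cast
  ring_nf

/-- A non-integrable function has Bochner integral 0, whereas the Fourier formula at `h = 0` gives
1. -/
theorem integrable_isotropicGaussian {b : ℝ} (hb : 0 < b) :
    Integrable (isotropicGaussian b : EuclideanSpace ℝ (Fin d) → ℝ) := by
  have h := integral_fourier_isotropicGaussian (d := d) hb 0
  simp only [inner_zero_left, Complex.ofReal_zero, mul_zero, Complex.exp_zero, one_mul, norm_zero,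
    ne_eq, OfNat.ofNat_ne_zero, not_false_eq_true, zero_pow, neg_zero, zero_div, Real.exp_zero,
    Complex.ofReal_one] at h
  rw [integral_complex_ofReal] at h
  by_contra hn
  rw [integral_undef hn] at h
  simp at h

theorem integral_isotropicGaussian {b : ℝ} (hb : 0 < b) :
    ∫ x : EuclideanSpace ℝ (Fin d), isotropicGaussian b x = 1 := by
  have h := integral_fourier_isotropicGaussian (d := d) hb 0
  simp only [inner_zero_left, Complex.ofReal_zero, mul_zero, Complex.exp_zero, one_mul, norm_zero,
    ne_eq, OfNat.ofNat_ne_zero, not_false_eq_true, zero_pow, neg_zero, zero_div, Real.exp_zero,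
    Complex.ofReal_one] at h
  rw [integral_complex_ofReal] at h
  exact_mod_cast h

theorem exists_orthonormalBasis_apply_eq {xt : EuclideanSpace ℝ (Fin d)} (hxt : ‖xt‖ = 1) :
    ∃ (B : OrthonormalBasis (Fin d) ℝ (EuclideanSpace ℝ (Fin d))) (j : Fin d), B j = xt := by
  -- A unit vector excludes `d = 0`.
  have hd : Nonempty (Fin d) := by
    by_contra hd
    rw [not_nonempty_iff] at hd
    rw [EuclideanSpace.norm_eq] at hxt
    simp at hxt
  obtain ⟨j⟩ := hd
  have ho : Orthonormal ℝ (({j} : Set (Fin d)).domRestrict fun _ ↦ xt) := by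
    refine ⟨fun _ ↦ hxt, fun a b hab ↦ (hab (Subsingleton.elim a b)).elim⟩
  obtain ⟨B, hB⟩ := ho.exists_orthonormalBasis_extension_of_card_eq (by simp)
  exact ⟨B, j, hB j rfl⟩

theorem integral_fourier_gaussian_real {b : ℝ} (hb : 0 < b) (c : ℝ) :
    ∫ x : ℝ, Complex.exp (Complex.I * (c * x : ℝ)) * (Real.exp (-b * x ^ 2) : ℂ) =
      (((Real.pi / b) ^ (1 / 2 : ℝ) * Real.exp (-c ^ 2 / (4 * b)) : ℝ) : ℂ) := by
  have hpi := Real.pi_pos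
  have h := fourierIntegral_gaussian (b := (b : ℂ)) (by simpa using hb) c
  have h2 : ((Real.pi : ℂ) / b) ^ (1 / 2 : ℂ) = (((Real.pi / b) ^ (1 / 2 : ℝ) : ℝ) : ℂ) := by
    rw [Complex.ofReal_cpow (by positivity)]
    push_cast
    rfl
  rw [h2] at h
  push_cast
  rw [← h]
  simp only [mul_assoc]

theorem integral_sign_fourier_isotropicGaussian {b : ℝ} (hb : 0 < b)
    {xt : EuclideanSpace ℝ (Fin d)} (hxt : ‖xt‖ = 1) (h : EuclideanSpace ℝ (Fin d)) :
    asymmetricPart xt (isotropicGaussian b) h =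
      ((1 / Real.sqrt (Real.pi * b) * Real.exp (-‖h‖ ^ 2 / (4 * b)) *
        ∫ y in (0 : ℝ)..inner ℝ h xt, Real.exp (y ^ 2 / (4 * b)) : ℝ) : ℂ) := by
  have hpi := Real.pi_pos
  obtain ⟨B, j, hj⟩ := exists_orthonormalBasis_apply_eq hxt
  have hxt_inner : ∀ x, inner ℝ x xt = B.repr x j := fun x ↦ by
    rw [B.repr_apply_apply, hj, real_inner_comm]
  set c := B.repr h
  let f : Fin d → ℝ → ℂ := fun i y ↦
    (if i = j then -Complex.I * (Real.sign y : ℂ) else 1) *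
      (Complex.exp (Complex.I * (c i * y : ℝ)) * (Real.exp (-b * y ^ 2) : ℂ))
  have hf : ∀ y : Fin d → ℝ,
      Complex.exp (Complex.I * (inner ℝ h (B.repr.symm (WithLp.toLp 2 y)) : ℝ)) *
        (-Complex.I * (Real.sign (inner ℝ (B.repr.symm (WithLp.toLp 2 y)) xt) : ℂ)) *
        (isotropicGaussian b (B.repr.symm (WithLp.toLp 2 y)) : ℂ) =
      (((b / Real.pi) ^ ((d : ℝ) / 2) : ℝ) : ℂ) * ∏ i, f i (y i) := by
    intro y
    have e1 : inner ℝ h (B.repr.symm (WithLp.toLp 2 y)) = ∑ i, c i * y i := by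
      rw [← B.repr.inner_map_map, LinearIsometryEquiv.apply_symm_apply, PiLp.inner_apply]
      exact Finset.sum_congr rfl fun i _ ↦ by simp [c, mul_comm]
    have e2 : ‖B.repr.symm (WithLp.toLp 2 y)‖ ^ 2 = ∑ i, y i ^ 2 := by
      rw [LinearIsometryEquiv.norm_map, EuclideanSpace.norm_sq_eq]
      simp
    have e3 : inner ℝ (B.repr.symm (WithLp.toLp 2 y)) xt = y j := by
      rw [hxt_inner, LinearIsometryEquiv.apply_symm_apply]
    simp only [f, Finset.prod_mul_distrib, Finset.prod_ite_eq', Finset.mem_univ, if_true]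
    rw [e1, e3, isotropicGaussian, e2, Finset.mul_sum, Real.exp_sum]
    push_cast
    rw [Finset.mul_sum, Complex.exp_sum]
    ring
  rw [asymmetricPart, B.integral_eq_integral_pi]
  simp_rw [hf]
  rw [integral_const_mul, integral_fintype_prod_volume_eq_prod,
    ← Finset.mul_prod_erase _ _ (Finset.mem_univ j)]
  have hfj : ∫ y, f j y = ((1 / b * Real.exp (-c j ^ 2 / (4 * b)) *
        ∫ y in (0 : ℝ)..c j, Real.exp (y ^ 2 / (4 * b)) : ℝ) : ℂ) := by
    rw [← integral_sign_fourier_gaussian hb]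
    congr 1
    funext y
    simp only [f, if_true]
    ring
  have hfi : ∀ i ∈ Finset.univ.erase j, ∫ y, f i y =
      (((Real.pi / b) ^ (1 / 2 : ℝ) * Real.exp (-c i ^ 2 / (4 * b)) : ℝ) : ℂ) := by
    intro i hi
    rw [← integral_fourier_gaussian_real hb]
    congr 1
    funext y
    simp only [f, if_neg (Finset.ne_of_mem_erase hi), one_mul]
  rw [hfj, Finset.prod_congr rfl hfi, ← Complex.ofReal_prod, ← Complex.ofReal_mul,
    ← Complex.ofReal_mul, hxt_inner]
  congr 1
  have hnorm : Real.exp (-‖h‖ ^ 2 / (4 * b)) = Real.exp (-c j ^ 2 / (4 * b)) *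
      ∏ i ∈ Finset.univ.erase j, Real.exp (-c i ^ 2 / (4 * b)) := by
    rw [Finset.mul_prod_erase _ (fun i ↦ Real.exp (-c i ^ 2 / (4 * b))) (Finset.mem_univ j),
      ← Real.exp_sum, ← Finset.sum_div, Finset.sum_neg_distrib, ← B.repr.norm_map,
      EuclideanSpace.norm_sq_eq]
    simp [c]
  -- Of the `d` normalising factors `√(b/π)`, the `d - 1` axes without sign absorb all but one, and
  -- `√(b/π) / b = 1 / √(π b)`.
  have hconst : (b / Real.pi) ^ ((d : ℝ) / 2) *
      (1 / b * ∏ i ∈ Finset.univ.erase j, (Real.pi / b) ^ (1 / 2 : ℝ)) =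
      1 / Real.sqrt (Real.pi * b) := by
    have h1 : (Real.pi / b) ^ (1 / 2 : ℝ) * ∏ i ∈ Finset.univ.erase j, (Real.pi / b) ^ (1 / 2 : ℝ) =
        (Real.pi / b) ^ ((d : ℝ) / 2) := by
      rw [Finset.mul_prod_erase _ (fun _ ↦ (Real.pi / b) ^ (1 / 2 : ℝ)) (Finset.mem_univ j),
        Finset.prod_const, Finset.card_univ, Fintype.card_fin, ← Real.rpow_natCast,
        ← Real.rpow_mul (by positivity)]
      ring_nf
    have h2 : (b / Real.pi) ^ ((d : ℝ) / 2) * (Real.pi / b) ^ ((d : ℝ) / 2) = 1 := by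
      rw [← Real.mul_rpow (by positivity) (by positivity),
        show b / Real.pi * (Real.pi / b) = 1 by field_simp, Real.one_rpow]
    have h3 : Real.sqrt (Real.pi * b) = b * (Real.pi / b) ^ (1 / 2 : ℝ) := by
      rw [← Real.sqrt_eq_rpow, Real.sqrt_eq_iff_mul_self_eq (by positivity) (by positivity),
        mul_mul_mul_comm, Real.mul_self_sqrt (by positivity)]
      field_simp
    have h4 : 0 < (Real.pi / b) ^ (1 / 2 : ℝ) := by positivity
    rw [h3, eq_div_iff (by positivity), mul_assoc, mul_right_comm, ← mul_assoc (1 / b),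
      one_div_mul_cancel hb.ne', one_mul, h1, h2]
  rw [hnorm, ← hconst, Finset.prod_mul_distrib]
  ring

/-! ### Pochhammer symbols and the hypergeometric series -/

theorem Real.Gamma_add_natCast_eq_ascPochhammer {s : ℝ} (hs : 0 < s) (n : ℕ) :
    Real.Gamma (s + n) = (ascPochhammer ℝ n).eval s * Real.Gamma s := by
  induction n with
  | zero => simp
  | succ n ih =>
    rw [Nat.cast_succ, ← add_assoc, Real.Gamma_add_one (by positivity), ih, ascPochhammer_succ_eval]
    ring

theorem ascPochhammer_eval_add_one_mul (s : ℝ) (n : ℕ) :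
    (ascPochhammer ℝ n).eval (s + 1) * s = (ascPochhammer ℝ n).eval s * (s + n) := by
  rw [← ascPochhammer_succ_eval, ascPochhammer_succ_left]
  simp [mul_comm]

theorem summable_norm_ordinaryHypergeometricSeries {a b c z : ℝ} (ha : 0 < a) (hb : 0 < b)
    (hc : 0 < c) (hz : |z| < 1) :
    Summable fun n ↦ ‖ordinaryHypergeometricSeries ℝ a b c n fun _ ↦ z‖ := by
  refine FormalMultilinearSeries.summable_norm_apply _ ?_
  rw [ordinaryHypergeometricSeries_radius_eq_one ℝ a b c]
  · rw [Metric.mem_eball, edist_zero_right, ← ofReal_norm, ENNReal.ofReal_lt_one]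
    exact hz
  · intro n
    have : (0 : ℝ) ≤ n := n.cast_nonneg
    refine ⟨?_, ?_, ?_⟩ <;> linarith

/-! ### The spectral density as a Gamma mixture -/

theorem integrableOn_rpow_mul_exp_neg_mul {s r : ℝ} (hs : 0 < s) (hr : 0 < r) :
    IntegrableOn (fun t : ℝ ↦ t ^ (s - 1) * Real.exp (-(r * t))) (Set.Ioi 0) := by
  have h := Real.integral_rpow_mul_exp_neg_mul_Ioi hs hr
  by_contra hn
  rw [integral_undef hn] at h
  have := Real.Gamma_pos_of_pos hs
  have : 0 < (1 / r) ^ s * Real.Gamma s := by positivity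
  linarith

/-- The density of the Gamma distribution with shape `α` and rate `1`, on `(0, ∞)`. -/
noncomputable def gammaWeight (α t : ℝ) : ℝ :=
  (Real.Gamma α)⁻¹ * (t ^ (α - 1) * Real.exp (-t))

theorem gammaWeight_nonneg {α t : ℝ} (hα : 0 < α) (ht : 0 < t) : 0 ≤ gammaWeight α t := by
  have := Real.Gamma_pos_of_pos hα
  unfold gammaWeight; positivity

theorem integrableOn_gammaWeight {α : ℝ} (hα : 0 < α) :
    IntegrableOn (gammaWeight α) (Set.Ioi 0) := by
  have h := (integrableOn_rpow_mul_exp_neg_mul hα one_pos).const_mul (Real.Gamma α)⁻¹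
  simpa only [one_mul] using! h

theorem integral_gammaWeight_mul_exp {α u : ℝ} (hα : 0 < α) (hu : 0 ≤ u) :
    ∫ t in Set.Ioi (0 : ℝ), gammaWeight α t * Real.exp (-(t * u)) = (1 + u) ^ (-α) := by
  have hΓ := Real.Gamma_pos_of_pos hα
  have h : ∀ t, gammaWeight α t * Real.exp (-(t * u)) =
      (Real.Gamma α)⁻¹ * (t ^ (α - 1) * Real.exp (-((1 + u) * t))) := by
    intro t
    rw [gammaWeight, mul_assoc, mul_assoc, ← Real.exp_add]
    ring_nf
  simp_rw [h]
  rw [integral_const_mul, Real.integral_rpow_mul_exp_neg_mul_Ioi hα (by positivity),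
    one_div, Real.inv_rpow (by positivity), Real.rpow_neg (by positivity)]
  field_simp

/-- The spectral density of the Cauchy covariance, as a Gamma mixture of Gaussian densities. -/
noncomputable def cauchySpectralDensity {d : ℕ} (a α : ℝ) (x : EuclideanSpace ℝ (Fin d)) : ℝ :=
  ∫ t in Set.Ioi (0 : ℝ), gammaWeight α t * isotropicGaussian (1 / (4 * (t * a ^ 2))) x

variable {a α : ℝ}

theorem integrable_gammaWeight_mul_isotropicGaussian (ha : 0 < a) (hα : 0 < α) :
    Integrable (fun p : ℝ × EuclideanSpace ℝ (Fin d) ↦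
      gammaWeight α p.1 * isotropicGaussian (1 / (4 * (p.1 * a ^ 2))) p.2)
      ((volume.restrict (Set.Ioi 0)).prod volume) := by
  have hm : Measurable (fun p : ℝ × EuclideanSpace ℝ (Fin d) ↦
      gammaWeight α p.1 * isotropicGaussian (1 / (4 * (p.1 * a ^ 2))) p.2) := by
    unfold gammaWeight isotropicGaussian
    fun_prop
  rw [integrable_prod_iff hm.aestronglyMeasurable]
  constructor
  · filter_upwards [ae_restrict_mem measurableSet_Ioi] with t ht
    have ht : 0 < t := ht
    exact (integrable_isotropicGaussian (by positivity)).const_mul _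
  · refine (integrableOn_gammaWeight hα).congr ?_
    filter_upwards [ae_restrict_mem measurableSet_Ioi] with t ht
    have ht : 0 < t := ht
    have hb : 0 < 1 / (4 * (t * a ^ 2)) := by positivity
    simp_rw [norm_mul, Real.norm_of_nonneg (isotropicGaussian_nonneg hb _)]
    rw [integral_const_mul, integral_isotropicGaussian hb, mul_one,
      Real.norm_of_nonneg (gammaWeight_nonneg hα ht)]

theorem integrable_cauchySpectralDensity (ha : 0 < a) (hα : 0 < α) :
    Integrable (cauchySpectralDensity a α : EuclideanSpace ℝ (Fin d) → ℝ) :=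
  (integrable_gammaWeight_mul_isotropicGaussian ha hα).integral_prod_right

theorem cauchySpectralDensity_nonneg (ha : 0 < a) (hα : 0 < α) (x : EuclideanSpace ℝ (Fin d)) :
    0 ≤ cauchySpectralDensity a α x := by
  refine setIntegral_nonneg measurableSet_Ioi fun t ht ↦ ?_
  have ht : 0 < t := ht
  exact mul_nonneg (gammaWeight_nonneg hα ht) (isotropicGaussian_nonneg (by positivity) x)

/-- Fubini for a general `m`, so that it serves both the plain exponential and the exponential times
the sign multiplier. -/
theorem integral_mul_cauchySpectralDensity (ha : 0 < a) (hα : 0 < α)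
    {m : EuclideanSpace ℝ (Fin d) → ℂ} (hm : Measurable m) (hb : ∀ x, ‖m x‖ ≤ 1) :
    ∫ x, m x * (cauchySpectralDensity a α x : ℂ) =
      ∫ t in Set.Ioi (0 : ℝ), (gammaWeight α t : ℂ) *
        ∫ x, m x * (isotropicGaussian (1 / (4 * (t * a ^ 2))) x : ℂ) := by
  have hi : Integrable (Function.uncurry fun (t : ℝ) (x : EuclideanSpace ℝ (Fin d)) ↦
      m x * ((gammaWeight α t * isotropicGaussian (1 / (4 * (t * a ^ 2))) x : ℝ) : ℂ))
      ((volume.restrict (Set.Ioi 0)).prod volume) := by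
    refine (integrable_gammaWeight_mul_isotropicGaussian ha hα).ofReal.bdd_mul (c := 1)
      (f := fun p ↦ m p.2) (hm.comp measurable_snd).aestronglyMeasurable (.of_forall fun p ↦ hb p.2)
  have hs := integral_integral_swap hi
  calc ∫ x, m x * (cauchySpectralDensity a α x : ℂ)
      = ∫ x, ∫ t in Set.Ioi (0 : ℝ),
          m x * ((gammaWeight α t * isotropicGaussian (1 / (4 * (t * a ^ 2))) x : ℝ) : ℂ) := by
        congr 1
        funext x
        rw [integral_const_mul, integral_complex_ofReal, cauchySpectralDensity]
    _ = _ := hs.symm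
    _ = _ := by
        congr 1
        funext t
        rw [← integral_const_mul]
        congr 1
        funext x
        push_cast
        ring

theorem norm_exp_I_mul_ofReal_le_one (r : ℝ) : ‖Complex.exp (Complex.I * (r : ℂ))‖ ≤ 1 := by
  rw [mul_comm, Complex.norm_exp_ofReal_mul_I]

theorem isSpectralDensity_cauchySpectralDensity (ha : 0 < a) (hα : 0 < α) :
    IsSpectralDensity (cauchyCovariance a α)
      (cauchySpectralDensity a α : EuclideanSpace ℝ (Fin d) → ℝ) where
  nonneg := cauchySpectralDensity_nonneg ha hα
  integrable := integrable_cauchySpectralDensity ha hα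
  eq_integral h := by
    rw [integral_mul_cauchySpectralDensity ha hα (by fun_prop)
      fun x ↦ norm_exp_I_mul_ofReal_le_one _]
    rw [cauchyCovariance, ← integral_gammaWeight_mul_exp hα (by positivity),
      ← integral_complex_ofReal]
    refine setIntegral_congr_fun measurableSet_Ioi fun t ht ↦ ?_
    have ht : 0 < t := ht
    rw [integral_fourier_isotropicGaussian (by positivity), ← Complex.ofReal_mul]
    congr 3
    field_simp

/-- Both densities define finite measures with characteristic function `C`, hence the same measure.
-/
theorem IsSpectralDensity.ae_eq {C f g : EuclideanSpace ℝ (Fin d) → ℝ}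
    (hf : IsSpectralDensity C f) (hg : IsSpectralDensity C g) : f =ᵐ[volume] g := by
  have hchar : ∀ {f : EuclideanSpace ℝ (Fin d) → ℝ}, IsSpectralDensity C f → ∀ h,
      charFun (volume.withDensity fun x ↦ ENNReal.ofReal (f x)) h = C h := by
    intro f hf h
    rw [charFun, integral_withDensity_eq_integral_toReal_smul₀
      hf.integrable.aemeasurable.ennreal_ofReal (.of_forall fun _ ↦ ENNReal.ofReal_lt_top),
      hf.eq_integral]
    congr 1
    funext x
    rw [ENNReal.toReal_ofReal (hf.nonneg x), real_inner_comm, Complex.real_smul,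
      mul_comm Complex.I, mul_comm]
  have hfin : ∀ {f : EuclideanSpace ℝ (Fin d) → ℝ}, IsSpectralDensity C f →
      IsFiniteMeasure (volume.withDensity fun x ↦ ENNReal.ofReal (f x)) :=
    fun hf ↦ isFiniteMeasure_withDensity_ofReal hf.integrable.2
  have := hfin hf
  have := hfin hg
  have heq : (volume.withDensity fun x ↦ ENNReal.ofReal (f x)) =
      volume.withDensity fun x ↦ ENNReal.ofReal (g x) :=
    Measure.ext_of_charFun (funext fun h ↦ (hchar hf h).trans (hchar hg h).symm)
  rw [withDensity_eq_iff hf.integrable.aemeasurable.ennreal_ofReal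
    hg.integrable.aemeasurable.ennreal_ofReal] at heq
  · filter_upwards [heq] with x hx
    exact (ENNReal.ofReal_eq_ofReal_iff (hf.nonneg x) (hg.nonneg x)).1 hx
  · rw [← ofReal_integral_eq_lintegral_ofReal hf.integrable (.of_forall hf.nonneg)]
    exact ENNReal.ofReal_ne_top

/-! ### Evaluation of the mixture integral -/

theorem asymmetricPart_cauchySpectralDensity (ha : 0 < a) (hα : 0 < α)
    {xt : EuclideanSpace ℝ (Fin d)} (hxt : ‖xt‖ = 1) (h : EuclideanSpace ℝ (Fin d)) :
    asymmetricPart xt (cauchySpectralDensity a α) h =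
      ((∫ t in Set.Ioi (0 : ℝ), 2 * a / (Real.sqrt Real.pi * Real.Gamma α) *
        (t ^ (α + 1 / 2 - 1) * Real.exp (-((a ^ 2 * ‖h‖ ^ 2 + 1) * t)) *
          ∫ y in (0 : ℝ)..inner ℝ h xt, Real.exp (t * a ^ 2 * y ^ 2)) : ℝ) : ℂ) := by
  have hpi := Real.pi_pos
  have hΓ := Real.Gamma_pos_of_pos hα
  have hsign := measurable_realSign
  rw [asymmetricPart, integral_mul_cauchySpectralDensity ha hα (by fun_prop) fun x ↦ ?_]
  · rw [← integral_complex_ofReal]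
    refine setIntegral_congr_fun measurableSet_Ioi fun t ht ↦ ?_
    have ht : 0 < t := ht
    have hb : 0 < 1 / (4 * (t * a ^ 2)) := by positivity
    have hI := integral_sign_fourier_isotropicGaussian hb hxt h
    rw [asymmetricPart] at hI
    rw [hI, ← Complex.ofReal_mul]
    congr 1
    have e1 : ∀ y : ℝ, y ^ 2 / (4 * (1 / (4 * (t * a ^ 2)))) = t * a ^ 2 * y ^ 2 := by
      intro y; field_simp
    have e2 : -‖h‖ ^ 2 / (4 * (1 / (4 * (t * a ^ 2)))) = -(a ^ 2 * ‖h‖ ^ 2 * t) := by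
      field_simp
    have e3 : Real.sqrt (Real.pi * (1 / (4 * (t * a ^ 2)))) =
        Real.sqrt Real.pi / (2 * a * t ^ (1 / 2 : ℝ)) := by
      rw [← Real.sqrt_eq_rpow, Real.sqrt_mul hpi.le, Real.sqrt_div zero_le_one, Real.sqrt_one,
        show 4 * (t * a ^ 2) = (2 * a) ^ 2 * t by ring, Real.sqrt_mul (by positivity),
        Real.sqrt_sq (by positivity)]
      ring
    have e4 : t ^ (α + 1 / 2 - 1) = t ^ (α - 1) * t ^ (1 / 2 : ℝ) := by
      rw [← Real.rpow_add ht]; ring_nf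
    have e5 : Real.exp (-((a ^ 2 * ‖h‖ ^ 2 + 1) * t)) =
        Real.exp (-t) * Real.exp (-(a ^ 2 * ‖h‖ ^ 2 * t)) := by
      rw [← Real.exp_add]; ring_nf
    simp_rw [e1]
    rw [e2, e3, e4, e5, gammaWeight, one_div_div]
    field_simp
  · rw [norm_mul, norm_mul, norm_neg, Complex.norm_I, one_mul, Complex.norm_real]
    exact mul_le_one₀ (norm_exp_I_mul_ofReal_le_one _) (norm_nonneg _) (abs_realSign_le_one _)

theorem integral_rpow_mul_exp_mul_integral_exp_sq (ha : 0 < a) (hα : 0 < α) {B c : ℝ}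
    (hB : 0 < B) (hc : a ^ 2 * c ^ 2 < B) :
    ∫ t in Set.Ioi (0 : ℝ), t ^ (α + 1 / 2 - 1) * Real.exp (-(B * t)) *
        ∫ y in (0 : ℝ)..c, Real.exp (t * a ^ 2 * y ^ 2) =
      (1 / B) ^ (α + 1 / 2) * Real.Gamma (α + 1 / 2) * c *
        ordinaryHypergeometric (1 / 2 : ℝ) (1 / 2 + α) (3 / 2) (a ^ 2 * c ^ 2 / B) := by
  set k : ℕ → ℝ := fun n ↦ (a ^ 2) ^ n * c ^ (2 * n + 1) / (n.factorial * (2 * n + 1))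
  set K : ℕ → ℝ → ℝ := fun n t ↦
    k n * (t ^ (α + 1 / 2 + n - 1) * Real.exp (-(B * t)))
  set P : ℝ := (1 / B) ^ (α + 1 / 2) * Real.Gamma (α + 1 / 2) * c
  set S : ℕ → ℝ := fun n ↦
    ordinaryHypergeometricSeries ℝ (1 / 2 : ℝ) (1 / 2 + α) (3 / 2) n fun _ ↦ a ^ 2 * c ^ 2 / B
  have hs : ∀ n : ℕ, 0 < α + 1 / 2 + n := fun n ↦ by positivity
  have hterm : ∀ n, k n * ((1 / B) ^ (α + 1 / 2 + n) * Real.Gamma (α + 1 / 2 + n)) = P * S n := by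
    intro n
    have h1 := ascPochhammer_eval_add_one_mul (1 / 2) n
    rw [show (1 / 2 : ℝ) + 1 = 3 / 2 by norm_num] at h1
    have h2 : 0 < (ascPochhammer ℝ n).eval (3 / 2 : ℝ) := ascPochhammer_pos n _ (by norm_num)
    -- This ratio turns the `1 / (2n + 1)` from integrating `y ^ (2n)` into the parameters `1/2` and
    -- `3/2`.
    have h3 : (ascPochhammer ℝ n).eval (1 / 2 : ℝ) * ((ascPochhammer ℝ n).eval (3 / 2 : ℝ))⁻¹ =
        1 / (2 * n + 1) := by
      field_simp
      linarith
    simp only [k, P, S]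
    rw [ordinaryHypergeometricSeries_apply_eq, Real.rpow_add_natCast (by positivity),
      Real.Gamma_add_natCast_eq_ascPochhammer (by positivity), smul_eq_mul,
      mul_right_comm (_ * _) _ (Polynomial.eval _ _)⁻¹, mul_assoc (_⁻¹) _ (_⁻¹), h3,
      add_comm (1 / 2) α, div_pow, div_pow, mul_pow, one_pow]
    field_simp
    ring
  have hS : Summable fun n ↦ ‖S n‖ := by
    refine summable_norm_ordinaryHypergeometricSeries (by norm_num) (by positivity) (by norm_num) ?_
    rw [abs_of_nonneg (by positivity), div_lt_one hB]
    exact hc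
  have hint : ∀ n, IntegrableOn (K n) (Set.Ioi 0) := fun n ↦
    (integrableOn_rpow_mul_exp_neg_mul (hs n) hB).const_mul _
  have hval : ∀ n, ∫ t in Set.Ioi (0 : ℝ), K n t = P * S n := fun n ↦ by
    rw [integral_const_mul, Real.integral_rpow_mul_exp_neg_mul_Ioi (hs n) hB, hterm]
  -- Each `K n` has constant sign on `(0, ∞)`, so its L¹ norm is the absolute value of its integral;
  -- absolute convergence inside the unit disc then justifies exchanging sum and integral.
  have hnorm : ∀ n, ∫ t in Set.Ioi (0 : ℝ), ‖K n t‖ = ‖P‖ * ‖S n‖ := fun n ↦ by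
    have : ∀ t ∈ Set.Ioi (0 : ℝ), ‖K n t‖ =
        ‖k n‖ * (t ^ (α + 1 / 2 + n - 1) * Real.exp (-(B * t))) := by
      intro t ht
      have ht : 0 < t := ht
      rw [norm_mul, Real.norm_of_nonneg (r := _ * _) (by positivity)]
    rw [setIntegral_congr_fun measurableSet_Ioi this, integral_const_mul,
      Real.integral_rpow_mul_exp_neg_mul_Ioi (hs n) hB, ← norm_mul, ← hterm, norm_mul,
      Real.norm_of_nonneg (mul_nonneg (by positivity) (Real.Gamma_pos_of_pos (hs n)).le)]
  have hsum := hasSum_integral_of_summable_integral_norm hint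
    ((hS.mul_left ‖P‖).congr fun n ↦ (hnorm n).symm)
  simp_rw [hval] at hsum
  have hgoal : ∫ t in Set.Ioi (0 : ℝ), t ^ (α + 1 / 2 - 1) * Real.exp (-(B * t)) *
        ∫ y in (0 : ℝ)..c, Real.exp (t * a ^ 2 * y ^ 2) = ∫ t in Set.Ioi (0 : ℝ), ∑' n, K n t := by
    refine setIntegral_congr_fun measurableSet_Ioi fun t ht ↦ ?_
    have ht : 0 < t := ht
    rw [← (hasSum_integral_exp_sq (t * a ^ 2) c).tsum_eq, ← tsum_mul_left]
    refine tsum_congr fun n ↦ ?_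
    simp only [K, k]
    rw [add_sub_right_comm _ (n : ℝ), Real.rpow_add_natCast ht.ne', mul_pow t]
    ring
  rw [hgoal, ← hsum.tsum_eq, tsum_mul_left]
  rfl

theorem proposition3 (d : ℕ) (a α : ℝ) (ha : 0 < a) (hα : 0 < α)
    (xt : EuclideanSpace ℝ (Fin d)) (hxt : ‖xt‖ = 1) :
    (∃ f : EuclideanSpace ℝ (Fin d) → ℝ, IsSpectralDensity (cauchyCovariance a α) f) ∧
    ∀ f : EuclideanSpace ℝ (Fin d) → ℝ, IsSpectralDensity (cauchyCovariance a α) f →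
      ∀ h : EuclideanSpace ℝ (Fin d),
        asymmetricPart xt f h =
          ((1 / (a ^ 2 * ‖h‖ ^ 2 + 1) ^ α * (2 / Real.sqrt Real.pi) *
              (Real.Gamma (α + 1 / 2) / Real.Gamma α) *
              (a * inner ℝ h xt / (a ^ 2 * ‖h‖ ^ 2 + 1) ^ (1 / 2 : ℝ)) *
              ordinaryHypergeometric (1 / 2 : ℝ) (1 / 2 + α) (3 / 2)
                (a ^ 2 * (inner ℝ h xt) ^ 2 / (a ^ 2 * ‖h‖ ^ 2 + 1)) : ℝ) : ℂ) := by
  refine ⟨⟨_, isSpectralDensity_cauchySpectralDensity ha hα⟩, fun f hf h ↦ ?_⟩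
  have hae : asymmetricPart xt f h = asymmetricPart xt (cauchySpectralDensity a α) h := by
    refine integral_congr_ae ?_
    filter_upwards [hf.ae_eq (isSpectralDensity_cauchySpectralDensity ha hα)] with x hx
    rw [hx]
  have hB : 0 < a ^ 2 * ‖h‖ ^ 2 + 1 := by positivity
  have hc : a ^ 2 * (inner ℝ h xt) ^ 2 < a ^ 2 * ‖h‖ ^ 2 + 1 := by
    have h1 : |inner ℝ h xt| ≤ ‖h‖ := by simpa [hxt] using abs_real_inner_le_norm h xt
    have h2 : (inner ℝ h xt) ^ 2 ≤ ‖h‖ ^ 2 := by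
      rw [← sq_abs]; gcongr
    have h3 : a ^ 2 * (inner ℝ h xt) ^ 2 ≤ a ^ 2 * ‖h‖ ^ 2 := by gcongr
    linarith
  rw [hae, asymmetricPart_cauchySpectralDensity ha hα hxt, integral_const_mul,
    integral_rpow_mul_exp_mul_integral_exp_sq ha hα hB hc]
  congr 1
  rw [one_div (a ^ 2 * ‖h‖ ^ 2 + 1), Real.inv_rpow hB.le, Real.rpow_add hB]
  ring
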